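/- Let $V_1,V_2$ be real vector spaces with a bilinear pairing $\langle\,,\,\rangle\colon V_1\times V_2\to\mathbb R$ (possibly degenerate), let $S$ be a set, and let $\Pi_1=\{\alpha_s\}_{s\in S}\subseteq V_1$ and $\Pi_2=\{\beta_s\}_{s\in S}\subseteq V_2$ be in bijective correspondence with $S$. For a subset $A$ of a real vector space let $\mathrm{PLC}(A)$ be the set of finite linear combinations of elements of $A$ with nonnegative coefficients, at least one of them positive. Assume: (D1) $\langle\alpha_s,\beta_s\rangle=1$ for all $s\in S$; (D2) $0\notin\mathrm{PLC}(\Pi_1)$, $0\notin\mathrm{PLC}(\Pi_2)$, and for each $s\in S$, $\alpha_s\notin\mathrm{PLC}(\Pi_1\setminus\{\alpha_s\})$ and $\beta_s\notin\mathrm{PLC}(\Pi_2\setminus\{\beta_s\})$. Let $\rho_1(s)x=x-2\langle x,\beta_s\rangle\alpha_s$ for $x\in V_1$ and $\rho_2(s)y=y-2\langle\alpha_s,y\rangle\beta_s$ for $y\in V_2$. For $i=1,2$ let $W_i\le\mathrm{GL}(V_i)$ be the subgroup generated by $\{\rho_i(s)\mid s\in S\}$, and put $\Phi_i=W_i\Pi_i$,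 $\Phi_i^+=\Phi_i\cap\mathrm{PLC}(\Pi_i)$, $\Phi_i^-=-\Phi_i^+$. Let $(W,R)$ with $R=\{r_s\mid s\in S\}$ be the Coxeter system with Coxeter matrix $(m_{st})$, where $m_{ss}=1$ and, for $s\ne t$, $m_{st}=m$ if $\langle\alpha_s,\beta_t\rangle\langle\alpha_t,\beta_s\rangle=\cos^2(\pi/m)$ for an (automatically unique) integer $m\ge2$, and $m_{st}=\infty$ otherwise. (a) $\Phi_1=\Phi_1^+\uplus\Phi_1^-$ if and only if $\Phi_2=\Phi_2^+\uplus\Phi_2^-$. (b) If these equivalent conditions hold, then there are group isomorphisms $f_1\colon W\to W_1$ and $f_2\colon W\to W_2$ with $f_1(r_s)=\rho_1(s)$ and $f_2(r_s)=\rho_2(s)$ for all $s\in S$. (c) Consequently, Coxeter groups are characterized as follows: for a group $G$ and a family $(r_s)_{s\in S}$ of elements of $G$, $G$ is a Coxeter group with family of Coxeter generators $(r_s)_{s\in S}$ (for some Coxeter matrix indexed by $S$) if and only if there are data $V_1,V_2,\langle\,,\,\rangle,(\alpha_s)_{s\in S},(\beta_s)_{s\in S}$ as above, satisfying (D1) and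 (D2), such that $\Phi_1=\Phi_1^+\uplus\Phi_1^-$ and there is an isomorphism $G\to W_1$ with $r_s\mapsto\rho_1(s)$ for all $s\in S$. -/

import Mathlib

universe u v₁ v₂ w w'

/-- The positive linear cone of `A`: finite linear combinations of elements of `A` with nonnegative
coefficients, at least one of which is positive. -/
def PLC {V : Type*} [AddCommGroup V] [Module ℝ V] (A : Set V) : Set V :=
  {v | ∃ c : V →₀ ℝ, (c.support : Set V) ⊆ A ∧ (∀ a, 0 ≤ c a) ∧ (∃ a ∈ A, 0 < c a) ∧
    v = c.sum fun a x => x • a}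

section RootSystem

variable {S V : Type*} [AddCommGroup V] [Module ℝ V]

/-- The subgroup of `GL(V)` generated by a family `ρ` of linear automorphisms. -/
def weylGroup (ρ : S → V ≃ₗ[ℝ] V) : Subgroup (V ≃ₗ[ℝ] V) :=
  Subgroup.closure (Set.range ρ)

/-- `Φ`: all images of the vectors `π s` under the group generated by `ρ`. -/
def rootSet (ρ : S → V ≃ₗ[ℝ] V) (π : S → V) : Set V :=
  {x | ∃ w ∈ weylGroup ρ, ∃ s, x = w (π s)}

/-- `Φ⁺ = Φ ∩ PLC(Π)`. -/
def posRoots (ρ : S → V ≃ₗ[ℝ] V) (π : S → V) : Set V :=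
  rootSet ρ π ∩ PLC (Set.range π)

/-- `Φ⁻ = -Φ⁺`. -/
def negRoots (ρ : S → V ≃ₗ[ℝ] V) (π : S → V) : Set V :=
  {x | -x ∈ posRoots ρ π}

/-- `Φ` is the disjoint union of `Φ⁺` and `Φ⁻`. -/
def RootsDecompose (ρ : S → V ≃ₗ[ℝ] V) (π : S → V) : Prop :=
  rootSet ρ π = posRoots ρ π ∪ negRoots ρ π ∧ Disjoint (posRoots ρ π) (negRoots ρ π)

end RootSystem

/-- Two real vector spaces with a bilinear pairing (possibly degenerate), and two families of
vectors satisfying conditions (D1) and (D2). Injectivity expresses that the sets `Π₁`, `Π₂` of these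
vectors are in bijection with the index set. -/
structure PairedRootDatum (S V₁ V₂ : Type*) [AddCommGroup V₁] [Module ℝ V₁]
    [AddCommGroup V₂] [Module ℝ V₂] where
  pairing : V₁ →ₗ[ℝ] V₂ →ₗ[ℝ] ℝ
  α : S → V₁
  β : S → V₂
  α_injective : Function.Injective α
  β_injective : Function.Injective β
  pairing_self : ∀ s, pairing (α s) (β s) = 1
  zero_notMem_α : (0 : V₁) ∉ PLC (Set.range α)
  zero_notMem_β : (0 : V₂) ∉ PLC (Set.range β)
  α_notMem : ∀ s, α s ∉ PLC (Set.range α \ {α s})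
  β_notMem : ∀ s, β s ∉ PLC (Set.range β \ {β s})

namespace PairedRootDatum

variable {S V₁ V₂ : Type*} [AddCommGroup V₁] [Module ℝ V₁] [AddCommGroup V₂] [Module ℝ V₂]
  (D : PairedRootDatum S V₁ V₂)

/-- `ρ₁(s) x = x - 2⟨x, β_s⟩ α_s`. -/
noncomputable def ρ₁ (s : S) : V₁ ≃ₗ[ℝ] V₁ :=
  Module.reflection (x := D.α s) (f := (2 : ℝ) • D.pairing.flip (D.β s))
    (by simp [D.pairing_self s])

/-- `ρ₂(s) y = y - 2⟨α_s, y⟩ β_s`. -/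
noncomputable def ρ₂ (s : S) : V₂ ≃ₗ[ℝ] V₂ :=
  Module.reflection (x := D.β s) (f := (2 : ℝ) • D.pairing (D.α s))
    (by simp [D.pairing_self s])

theorem ρ₁_apply (s : S) (x : V₁) :
    D.ρ₁ s x = x - (2 * D.pairing x (D.β s)) • D.α s := by
  simp [ρ₁, Module.reflection_apply]

theorem ρ₂_apply (s : S) (y : V₂) :
    D.ρ₂ s y = y - (2 * D.pairing (D.α s) y) • D.β s := by
  simp [ρ₂, Module.reflection_apply]

/-- `W₁ ≤ GL(V₁)`. -/
noncomputable def W₁ : Subgroup (V₁ ≃ₗ[ℝ] V₁) := weylGroup D.ρ₁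

/-- `W₂ ≤ GL(V₂)`. -/
noncomputable def W₂ : Subgroup (V₂ ≃ₗ[ℝ] V₂) := weylGroup D.ρ₂

/-- `Φ₁ = Φ₁⁺ ⊎ Φ₁⁻`. -/
def Decomposes₁ : Prop := RootsDecompose D.ρ₁ D.α

/-- `Φ₂ = Φ₂⁺ ⊎ Φ₂⁻`. -/
def Decomposes₂ : Prop := RootsDecompose D.ρ₂ D.β

open Classical in
/-- The number `m_{st}`: it is `1` for `s = t`; for `s ≠ t` it is the integer `m ≥ 2` with
`⟨α_s, β_t⟩⟨α_t, β_s⟩ = cos²(π/m)` if there is one (it is then unique), and otherwise `∞`, which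
Mathlib encodes as `0` in Coxeter matrices. -/
noncomputable def order (s t : S) : ℕ :=
  if s = t then 1
  else if h : ∃ m : ℕ, 2 ≤ m ∧ D.pairing (D.α s) (D.β t) * D.pairing (D.α t) (D.β s)
      = Real.cos (Real.pi / m) ^ 2 then Nat.find h
  else 0

theorem order_symm (s t : S) : D.order s t = D.order t s := by
  have h : D.pairing (D.α s) (D.β t) * D.pairing (D.α t) (D.β s)
      = D.pairing (D.α t) (D.β s) * D.pairing (D.α s) (D.β t) := mul_comm _ _
  by_cases hst : s = t
  · rw [hst]
  · unfold order
    rw [if_neg hst, if_neg (Ne.symm hst)]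
    generalize D.pairing (D.α s) (D.β t) * D.pairing (D.α t) (D.β s) = p at h
    rw [← h]

theorem order_ne_one {s t : S} (hst : s ≠ t) : D.order s t ≠ 1 := by
  classical
  unfold order
  rw [if_neg hst]
  split_ifs with h
  · have := (Nat.find_spec h).1
    omega
  · exact zero_ne_one

/-- The Coxeter matrix `(m_{st})` of the abstract Coxeter system of the datum. -/
noncomputable def coxeterMatrix : CoxeterMatrix S where
  M := Matrix.of D.order
  isSymm := Matrix.IsSymm.ext fun s t => D.order_symm t s
  diagonal s := by simp [order]
  off_diagonal _ _ h := D.order_ne_one h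

end PairedRootDatum

/-! Everything depends only on the Cartan entries `c_st = ⟨α_s, β_t⟩`. Root decomposition on either
side is equivalent to `IsAdmissible`: off the diagonal the entries are nonpositive, vanish in
symmetric pairs, and `c_st * c_ts` is either at least 1 or some `cos² (π/m)`. This is invariant
under transposition, which gives (a).

Necessity is a rank two statement. After rescaling, alternating products of two reflections send
`α_s` to combinations of `α_s, α_t` with Chebyshev coefficients. The simple roots may be linearly
dependent, but (D2) still forbids roots with coefficients of opposite sign
(`Decomposes₁.not_mixed`), while the Chebyshev sequence changes sign strictly unless `c ≥ 1` or `c =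
cos (π/m)`.

Conversely, the same formulas give the Coxeter relations (`IsScaling.pow_eq_one`), hence a
representation of `W`. Induction on length, splitting off a rank two factor, shows that `w α_s` is
positive when `s` is not a right descent of `w` and negative otherwise (`rep_apply_α_mem_PLC`). This
yields both the decomposition and faithfulness, since a nontrivial `w` has a descent. For (c), the
standard reflection representation realizes every Coxeter matrix. -/

/-! ### Positive cones and their extreme generators. -/

section Cone

variable {V : Type*} [AddCommGroup V] [Module ℝ V] {A B : Set V} {x y : V}

theorem mem_PLC_iff : x ∈ PLC A ↔ ∃ c : V →₀ ℝ, (c.support : Set V) ⊆ A ∧ 0 ≤ c ∧ c ≠ 0 ∧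
    x = Finsupp.linearCombination ℝ id c := by
  constructor
  · rintro ⟨c, hc, h0, ⟨a, -, ha⟩, rfl⟩
    exact ⟨c, hc, h0, fun h => by simp [h] at ha, rfl⟩
  · rintro ⟨c, hc, h0, hne, rfl⟩
    obtain ⟨a, ha⟩ := Finsupp.ne_iff.mp hne
    exact ⟨c, hc, h0, ⟨a, hc (by simpa using ha), lt_of_le_of_ne (h0 a) (Ne.symm ha)⟩, rfl⟩

theorem mem_PLC_of_mem (hx : x ∈ A) : x ∈ PLC A :=
  mem_PLC_iff.2 ⟨Finsupp.single x 1,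
    (Finset.coe_subset.2 Finsupp.support_single_subset).trans (by simpa using hx),
    by simp, by simp, by simp⟩

theorem PLC_mono (h : A ⊆ B) : PLC A ⊆ PLC B := by
  intro x hx
  obtain ⟨c, hc, h0, hne, rfl⟩ := mem_PLC_iff.1 hx
  exact mem_PLC_iff.2 ⟨c, hc.trans h, h0, hne, rfl⟩

/-- A nonnegative combination over `A` is a positive one or zero. -/
theorem linearCombination_eq_zero_or_mem_PLC {c : V →₀ ℝ} (hc : (c.support : Set V) ⊆ A)
    (h0 : 0 ≤ c) : Finsupp.linearCombination ℝ id c = 0 ∨ Finsupp.linearCombination ℝ id c ∈ PLC A := by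
  by_cases h : c = 0
  · simp [h]
  · exact Or.inr (mem_PLC_iff.2 ⟨c, hc, h0, h, rfl⟩)

theorem add_mem_PLC (hx : x ∈ PLC A) (hy : y ∈ PLC A) : x + y ∈ PLC A := by
  classical
  obtain ⟨c, hc, h0, hne, rfl⟩ := mem_PLC_iff.1 hx
  obtain ⟨d, hd, k0, -, rfl⟩ := mem_PLC_iff.1 hy
  refine mem_PLC_iff.2 ⟨c + d, ?_, add_nonneg h0 k0, ?_, by simp⟩
  · intro a ha
    rcases Finset.mem_union.1 (Finsupp.support_add ha) with h | h
    exacts [hc h, hd h]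
  · exact fun h => hne (le_antisymm (h ▸ le_add_of_nonneg_right k0) h0)

theorem smul_mem_PLC (hx : x ∈ PLC A) {r : ℝ} (hr : 0 < r) : r • x ∈ PLC A := by
  obtain ⟨c, hc, h0, hne, rfl⟩ := mem_PLC_iff.1 hx
  refine mem_PLC_iff.2 ⟨r • c, (Finset.coe_subset.2 Finsupp.support_smul).trans hc, ?_,
    smul_ne_zero hr.ne' hne, by simp⟩
  intro a
  simpa using mul_nonneg hr.le (h0 a)

theorem smul_add_smul_mem_PLC (hx : x ∈ PLC A) (hy : y ∈ PLC A) {p q : ℝ} (hp : 0 ≤ p) (hq : 0 ≤ q)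
    (h : p ≠ 0 ∨ q ≠ 0) : p • x + q • y ∈ PLC A := by
  rcases hp.eq_or_lt with rfl | hp
  · simpa using smul_mem_PLC hy (hq.lt_of_ne' (by simpa using h))
  rcases hq.eq_or_lt with rfl | hq
  · simpa using smul_mem_PLC hx hp
  · exact add_mem_PLC (smul_mem_PLC hx hp) (smul_mem_PLC hy hq)

theorem map_pos_of_mem_PLC (f : V →ₗ[ℝ] ℝ) (hf : ∀ a ∈ A, 0 < f a) (hx : x ∈ PLC A) : 0 < f x := by
  obtain ⟨c, hc, h0, ⟨a, ha, hca⟩, rfl⟩ := hx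
  rw [Finsupp.sum, map_sum]
  simp only [map_smul, smul_eq_mul]
  exact Finset.sum_pos' (fun b hb => mul_nonneg (h0 b) (hf b (hc hb)).le)
    ⟨a, by simpa using hca.ne', mul_pos hca (hf a ha)⟩

theorem map_eq_zero_of_mem_PLC (f : V →ₗ[ℝ] ℝ) (hf : ∀ a ∈ A, f a = 0) (hx : x ∈ PLC A) :
    f x = 0 := by
  obtain ⟨c, hc, -, -, rfl⟩ := hx
  rw [Finsupp.sum, map_sum]
  exact Finset.sum_eq_zero fun a ha => by rw [map_smul, hf a (hc ha), smul_zero]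

theorem neg_notMem_PLC (h0 : (0 : V) ∉ PLC A) (hx : x ∈ PLC A) : -x ∉ PLC A :=
  fun h => h0 (by simpa using add_mem_PLC hx h)

/-- If `x` is an extreme generator of a pointed cone, then a combination with a negative coefficient
at another generator leaves the cone. -/
theorem smul_sub_smul_notMem_PLC (h0 : (0 : V) ∉ PLC A) (hx : x ∈ A) (hy : y ∈ A) (hxy : y ≠ x)
    (hext : x ∉ PLC (A \ {x})) {p q : ℝ} (hq : 0 < q) :
    p • x - q • y ∉ PLC A := by
  classical
  intro h
  obtain ⟨c, hc, hc0, -, h⟩ := mem_PLC_iff.1 h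
  have hsplit : Finsupp.linearCombination ℝ id c =
      c x • x + Finsupp.linearCombination ℝ id (c.erase x) := by
    conv_lhs => rw [← Finsupp.single_add_erase x c]
    simp
  have hz : q • y + Finsupp.linearCombination ℝ id (c.erase x) ∈ PLC (A \ {x}) := by
    have hyA : y ∈ A \ {x} := ⟨hy, hxy⟩
    have hy' : q • y ∈ PLC (A \ {x}) := smul_mem_PLC (mem_PLC_of_mem hyA) hq
    have hsupp : ((c.erase x).support : Set V) ⊆ A \ {x} := by
      intro a ha
      simp only [Finsupp.support_erase, Finset.coe_erase] at ha
      exact ⟨hc ha.1, ha.2⟩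
    have hnonneg : 0 ≤ c.erase x := by
      intro a
      by_cases hax : a = x
      · simp [hax]
      · simpa [Finsupp.erase_ne hax] using hc0 a
    rcases linearCombination_eq_zero_or_mem_PLC hsupp hnonneg with h' | h'
    · simpa [h'] using hy'
    · exact add_mem_PLC hy' h'
  have heq : q • y + Finsupp.linearCombination ℝ id (c.erase x) = (p - c x) • x := by
    rw [hsplit] at h
    rw [sub_smul, sub_eq_iff_eq_add.1 h]
    abel
  rw [heq] at hz
  -- A positive multiple of `x` in the cone over the other generators contradicts extremality; a
  -- nonpositive one puts 0 in the cone over `A`.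
  rcases lt_or_ge 0 (p - c x) with hlt | hle
  · exact hext (by simpa [smul_smul, hlt.ne'] using smul_mem_PLC hz (inv_pos.2 hlt))
  · have hz' := PLC_mono Set.sdiff_subset hz
    rcases hle.eq_or_lt with he | hlt
    · exact h0 (by simpa [he] using hz')
    · have := add_mem_PLC hz' (smul_mem_PLC (mem_PLC_of_mem hx) (neg_pos.2 hlt))
      exact h0 (by simpa [← add_smul] using this)

end Cone

/-! ### Signs of the Chebyshev sequence. -/

section Chebyshev

/-- The numbers `U_{n-1}(c)`, where `U` denotes the Chebyshev polynomials of the second kind. -/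
noncomputable def chebU (c : ℝ) : ℕ → ℝ
  | 0 => 0
  | 1 => 1
  | n + 2 => 2 * c * chebU c (n + 1) - chebU c n

@[simp] theorem chebU_zero (c : ℝ) : chebU c 0 = 0 := rfl

@[simp] theorem chebU_one (c : ℝ) : chebU c 1 = 1 := rfl

theorem chebU_add_two (c : ℝ) (n : ℕ) :
    chebU c (n + 2) = 2 * c * chebU c (n + 1) - chebU c n := rfl

theorem chebU_cos_mul_sin (θ : ℝ) (n : ℕ) :
    chebU (Real.cos θ) n * Real.sin θ = Real.sin (n * θ) := by
  induction n using Nat.twoStepInduction with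
  | zero => simp
  | one => simp
  | more n h₁ h₂ =>
    have e₁ : ((n + 2 : ℕ) : ℝ) * θ = (n + 1 : ℕ) * θ + θ := by push_cast; ring
    have e₂ : (n : ℝ) * θ = (n + 1 : ℕ) * θ - θ := by push_cast; ring
    rw [chebU_add_two, sub_mul, mul_assoc, h₁, h₂, e₁, e₂, Real.sin_add, Real.sin_sub]
    ring

theorem chebU_nonneg_of_one_le {c : ℝ} (hc : 1 ≤ c) (n : ℕ) :
    0 ≤ chebU c n ∧ chebU c n ≤ chebU c (n + 1) := by
  induction n with
  | zero => simp
  | succ n ih =>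
    refine ⟨ih.1.trans ih.2, ?_⟩
    rw [chebU_add_two]
    nlinarith [ih.1.trans ih.2]

theorem sin_pi_div_pos {m : ℕ} (hm : 2 ≤ m) : 0 < Real.sin (Real.pi / m) := by
  have hm' : (2 : ℝ) ≤ m := by exact_mod_cast hm
  exact Real.sin_pos_of_pos_of_lt_pi (by positivity) (div_lt_self Real.pi_pos (by linarith))

theorem cos_pi_div_nonneg {m : ℕ} (hm : 2 ≤ m) : 0 ≤ Real.cos (Real.pi / m) := by
  have hm' : (2 : ℝ) ≤ m := by exact_mod_cast hm
  have h : Real.pi / m ≤ Real.pi / 2 :=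
    div_le_div_of_nonneg_left Real.pi_pos.le (by norm_num) hm'
  exact Real.cos_nonneg_of_neg_pi_div_two_le_of_le
    (by linarith [Real.pi_pos, show 0 ≤ Real.pi / m by positivity]) h

theorem cos_pi_div_sq_lt_one {m : ℕ} (hm : 2 ≤ m) : Real.cos (Real.pi / m) ^ 2 < 1 := by
  nlinarith [sin_pi_div_pos hm, Real.sin_sq_add_cos_sq (Real.pi / m)]

/-- Both angles lie in `[0, π/2]`, where cosine is nonnegative and injective. Hence the integer
found by `order` is the expected one. -/
theorem cos_pi_div_sq_inj {m n : ℕ} (hm : 2 ≤ m) (hn : 2 ≤ n)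
    (h : Real.cos (Real.pi / m) ^ 2 = Real.cos (Real.pi / n) ^ 2) : m = n := by
  have hm' : (2 : ℝ) ≤ m := by exact_mod_cast hm
  have hn' : (2 : ℝ) ≤ n := by exact_mod_cast hn
  have h := (pow_left_inj₀ (cos_pi_div_nonneg hm) (cos_pi_div_nonneg hn) two_ne_zero).1 h
  have h := Real.injOn_cos
    ⟨by positivity, div_le_self Real.pi_pos.le (by linarith)⟩
    ⟨by positivity, div_le_self Real.pi_pos.le (by linarith)⟩ h
  have : (m : ℝ) = n := by
    field_simp at h
    linarith
  exact_mod_cast this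

theorem chebU_cos_pi_div_nonneg {m n : ℕ} (hm : 2 ≤ m) (hn : n ≤ m) :
    0 ≤ chebU (Real.cos (Real.pi / m)) n := by
  have hs := sin_pi_div_pos hm
  refine nonneg_of_mul_nonneg_left ?_ hs
  rw [chebU_cos_mul_sin]
  have hm' : (0 : ℝ) < m := by exact_mod_cast (by omega : 0 < m)
  have hn' : (n : ℝ) ≤ m := by exact_mod_cast hn
  refine Real.sin_nonneg_of_nonneg_of_le_pi (by positivity) ?_
  rw [mul_div_assoc', div_le_iff₀ hm', mul_comm]
  exact mul_le_mul_of_nonneg_left hn' Real.pi_pos.le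

theorem chebU_cos_pi_div_two_mul {m : ℕ} (hm : 2 ≤ m) :
    chebU (Real.cos (Real.pi / m)) (2 * m) = 0 := by
  have hm' : (m : ℝ) ≠ 0 := by exact_mod_cast (by omega : m ≠ 0)
  refine (mul_eq_zero.1 ?_).resolve_right (sin_pi_div_pos hm).ne'
  rw [chebU_cos_mul_sin, show ((2 * m : ℕ) : ℝ) * (Real.pi / m) = 2 * Real.pi by
    push_cast; field_simp, Real.sin_two_pi]

theorem chebU_cos_pi_div_two_mul_add_one {m : ℕ} (hm : 2 ≤ m) :
    chebU (Real.cos (Real.pi / m)) (2 * m + 1) = 1 := by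
  have hm' : (m : ℝ) ≠ 0 := by exact_mod_cast (by omega : m ≠ 0)
  refine mul_right_cancel₀ (sin_pi_div_pos hm).ne' ?_
  rw [chebU_cos_mul_sin, show ((2 * m + 1 : ℕ) : ℝ) * (Real.pi / m) = Real.pi / m + 2 * Real.pi by
    push_cast; field_simp; ring, Real.sin_add_two_pi, one_mul]

/-- If `0 ≤ c < 1` is not of the form `cos (π / m)`, the sequence `chebU c` changes sign strictly. -/
theorem exists_eq_cos_pi_div_or_chebU_sign_change {c : ℝ} (h0 : 0 ≤ c) (h1 : c < 1) :
    (∃ m : ℕ, 2 ≤ m ∧ c = Real.cos (Real.pi / m)) ∨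
      ∃ n : ℕ, 0 < chebU c n ∧ chebU c (n + 1) < 0 := by
  have hcos : Real.cos (Real.arccos c) = c := Real.cos_arccos (by linarith) h1.le
  have hθ : 0 < Real.arccos c := Real.arccos_pos.2 h1
  have hθ' : Real.arccos c ≤ Real.pi / 2 := Real.arccos_le_pi_div_two.2 h0
  generalize Real.arccos c = θ at *
  subst hcos
  have hπ := Real.pi_pos
  have hsin : 0 < Real.sin θ := Real.sin_pos_of_pos_of_lt_pi hθ (by linarith)
  -- With `n + 1` this ceiling, `n * θ < π ≤ (n + 1) * θ`. Equality gives `θ = π/(n + 1)`; otherwise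
  -- the sine turns negative exactly between these two multiples.
  have hpos : 0 < ⌈Real.pi / θ⌉₊ := Nat.ceil_pos.2 (by positivity)
  obtain ⟨n, hn⟩ := Nat.exists_eq_succ_of_ne_zero hpos.ne'
  have hle : Real.pi ≤ ((n + 1 : ℕ) : ℝ) * θ := by
    rw [← div_le_iff₀ hθ]
    exact (Nat.le_ceil _).trans (by rw [hn])
  have hlt : (n : ℝ) * θ < Real.pi := by
    rw [← lt_div_iff₀ hθ]
    exact Nat.lt_ceil.1 (by omega)
  have hn0 : 0 < n := by
    rcases Nat.eq_zero_or_pos n with rfl | h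
    · norm_num at hle; linarith
    · exact h
  rcases hle.eq_or_lt with he | hl
  · refine Or.inl ⟨n + 1, by omega, ?_⟩
    have : ((n + 1 : ℕ) : ℝ) ≠ 0 := by positivity
    rw [he, mul_div_cancel_left₀ _ this]
  · refine Or.inr ⟨n, ?_, ?_⟩
    · refine pos_of_mul_pos_left (b := Real.sin θ) ?_ hsin.le
      rw [chebU_cos_mul_sin]
      exact Real.sin_pos_of_pos_of_lt_pi (by positivity) hlt
    · refine neg_of_mul_neg_left (b := Real.sin θ) ?_ hsin.le
      rw [chebU_cos_mul_sin, ← Real.sin_sub_two_pi]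
      push_cast at *
      refine Real.sin_neg_of_neg_of_neg_pi_lt ?_ ?_ <;> nlinarith

end Chebyshev

/-! ### Rank two factorizations in a Coxeter group. -/

namespace CoxeterSystem

variable {B W : Type*} [Group W] {M : CoxeterMatrix B} (cs : CoxeterSystem M W)

theorem length_mul_wordProd_le (w : W) (ω : List B) :
    cs.length (w * cs.wordProd ω) ≤ cs.length w + ω.length :=
  (cs.length_mul_le _ _).trans (Nat.add_le_add_left (cs.length_wordProd_le ω) _)

/-- If `w` has a right descent `t` but not `s`, then `w` has a length-additive factorization `v * u`
with `u` alternating in `s`, `t` and `v` without right descent in `{s, t}`. -/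
theorem exists_mul_alternatingWord {w : W} {s t : B} (hs : ¬ cs.IsRightDescent w s)
    (ht : cs.IsRightDescent w t) :
    ∃ (v : W) (k : ℕ), w = v * cs.wordProd (alternatingWord s t k) ∧ cs.length v < cs.length w ∧
      ¬ cs.IsRightDescent v s ∧ ¬ cs.IsRightDescent v t ∧ (M s t ≠ 0 → k < M s t) := by
  classical
  -- `P k`: the alternating word of length `k` ending in `t` splits off `w` with lengths adding. A
  -- maximal such `k` is taken.
  let P : ℕ → Prop := fun k => ∃ v, w = v * cs.wordProd (alternatingWord s t k) ∧
    cs.length w = cs.length v + k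
  have hP1 : P 1 := by
    refine ⟨w * cs.simple t, by simp [alternatingWord], ?_⟩
    exact (cs.isRightDescent_iff.1 ht).symm
  have hPle : ∀ k, P k → k ≤ cs.length w := fun k ⟨v, _, h⟩ => by omega
  have hPdown : ∀ k, P (k + 1) → P k := by
    rintro k ⟨v, hv, hl⟩
    rw [alternatingWord_succ', wordProd_cons, ← mul_assoc] at hv
    refine ⟨_, hv, ?_⟩
    have h₁ := cs.length_mul_wordProd_le (v * cs.simple (if Even k then t else s))
      (alternatingWord s t k)
    rw [← hv, length_alternatingWord] at h₁
    rcases cs.length_mul_simple v (if Even k then t else s) with h | h <;> omega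
  obtain ⟨k, ⟨v, hv, hl⟩, hk1, hmax⟩ : ∃ k, P k ∧ 1 ≤ k ∧ ¬ P (k + 1) := by
    refine ⟨Nat.findGreatest P (cs.length w), Nat.findGreatest_spec (hPle 1 hP1) hP1,
      Nat.le_findGreatest (hPle 1 hP1) hP1, fun h => ?_⟩
    have := Nat.le_findGreatest (hPle _ h) h
    omega
  -- This letter would extend the alternating word on the left, against maximality.
  have hnext : ¬ cs.IsRightDescent v (if Even k then t else s) := by
    intro h
    refine hmax ⟨v * cs.simple (if Even k then t else s), ?_, ?_⟩
    · rw [alternatingWord_succ', wordProd_cons, ← mul_assoc, simple_mul_simple_cancel_right, hv]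
    · have := cs.isRightDescent_iff.1 h
      omega
  -- This is the first letter of the alternating word; as a descent of `v` it would cancel and make
  -- `w` too short.
  have hfirst : ¬ cs.IsRightDescent v (if Even k then s else t) := by
    intro h
    obtain ⟨j, rfl⟩ := Nat.exists_eq_add_of_le' hk1
    have hite : (if Even (j + 1) then s else t) = if Even j then t else s := by
      by_cases hj : Even j <;> simp [Nat.even_add_one, hj]
    rw [hite] at h
    rw [alternatingWord_succ', wordProd_cons, ← mul_assoc] at hv
    have h₁ := cs.length_mul_wordProd_le (v * cs.simple (if Even j then t else s))
      (alternatingWord s t j)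
    rw [← hv, length_alternatingWord] at h₁
    have := cs.isRightDescent_iff.1 h
    omega
  refine ⟨v, k, hv, by omega, ?_, ?_, ?_⟩
  · split_ifs at hnext hfirst <;> assumption
  · split_ifs at hnext hfirst <;> assumption
  · intro hM
    -- Otherwise a full braid word splits off; the braid relation rewrites it to end in `s`, making
    -- `s` a right descent of `w`.
    by_contra! hMk
    obtain ⟨u, hu, hul⟩ : P (M s t) :=
      Nat.decreasingInduction (motive := fun j _ => P j) (fun j _ h => hPdown j h) ⟨v, hv, hl⟩ hMk
    obtain ⟨j, hj⟩ := Nat.exists_eq_succ_of_ne_zero hM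
    have hbraid := cs.wordProd_braidWord_eq s t
    rw [braidWord, braidWord, ← M.symmetric s t] at hbraid
    rw [hbraid, hj, Nat.succ_eq_add_one, alternatingWord_succ, wordProd_concat, ← mul_assoc] at hu
    apply hs
    have h₁ := cs.length_mul_wordProd_le u (alternatingWord s t j)
    rw [length_alternatingWord] at h₁
    rw [IsRightDescent, hu, simple_mul_simple_cancel_right, ← hu]
    omega

end CoxeterSystem

/-! ### The Cartan matrix and rank two computations. -/

namespace PairedRootDatum

open CoxeterSystem

variable {S V₁ V₂ : Type*} [AddCommGroup V₁] [Module ℝ V₁] [AddCommGroup V₂] [Module ℝ V₂]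
  (D : PairedRootDatum S V₁ V₂)

/-- The datum with the roles of the two vector spaces exchanged. -/
def swap : PairedRootDatum S V₂ V₁ where
  pairing := D.pairing.flip
  α := D.β
  β := D.α
  α_injective := D.β_injective
  β_injective := D.α_injective
  pairing_self := D.pairing_self
  zero_notMem_α := D.zero_notMem_β
  zero_notMem_β := D.zero_notMem_α
  α_notMem := D.β_notMem
  β_notMem := D.α_notMem

theorem swap_coxeterMatrix : D.swap.coxeterMatrix = D.coxeterMatrix := by
  refine CoxeterMatrix.ext (funext fun s => funext fun t => ?_)
  change D.swap.order s t = D.order s t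
  rw [D.order_symm]
  by_cases hst : s = t
  · simp [order, hst]
  · unfold order
    rw [if_neg hst, if_neg (Ne.symm hst)]
    rfl

/-- The entry `⟨α_s, β_t⟩` of the Cartan matrix of the datum. -/
def cartan (s t : S) : ℝ := D.pairing (D.α s) (D.β t)

@[simp] theorem cartan_self (s : S) : D.cartan s s = 1 := D.pairing_self s

theorem order_eq_of_cartan_mul {s t : S} (hst : s ≠ t) {m : ℕ} (hm : 2 ≤ m)
    (h : D.cartan s t * D.cartan t s = Real.cos (Real.pi / m) ^ 2) : D.order s t = m := by
  classical
  have hex : ∃ m : ℕ, 2 ≤ m ∧ D.pairing (D.α s) (D.β t) * D.pairing (D.α t) (D.β s)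
      = Real.cos (Real.pi / m) ^ 2 := ⟨m, hm, h⟩
  unfold order
  rw [if_neg hst, dif_pos hex]
  obtain ⟨h₁, h₂⟩ := Nat.find_spec hex
  exact cos_pi_div_sq_inj h₁ hm (h₂.symm.trans h)

theorem order_eq_zero_of_one_le_cartan_mul {s t : S} (hst : s ≠ t)
    (h : 1 ≤ D.cartan s t * D.cartan t s) : D.order s t = 0 := by
  unfold order
  rw [if_neg hst, dif_neg]
  rintro ⟨m, hm, h'⟩
  exact absurd (cos_pi_div_sq_lt_one hm) (not_lt.2 (h.trans_eq h'))

theorem ρ₁_α (s t : S) : D.ρ₁ s (D.α t) = D.α t - (2 * D.cartan t s) • D.α s :=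
  D.ρ₁_apply s _

theorem ρ₁_α_self (s : S) : D.ρ₁ s (D.α s) = -D.α s := by
  rw [ρ₁_α, cartan_self]
  module

theorem ρ₁_mul_self (s : S) : D.ρ₁ s * D.ρ₁ s = 1 :=
  LinearEquiv.ext fun x => Module.involutive_reflection _ x

theorem α_mem_PLC (s : S) : D.α s ∈ PLC (Set.range D.α) := mem_PLC_of_mem ⟨s, rfl⟩

theorem α_ne_zero (s : S) : D.α s ≠ 0 := fun h => D.zero_notMem_α (h ▸ D.α_mem_PLC s)

/-- The product of the reflections along a word. -/
noncomputable def wordAct (ω : List S) : V₁ ≃ₗ[ℝ] V₁ := (ω.map D.ρ₁).prod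

theorem wordAct_cons (s : S) (ω : List S) : D.wordAct (s :: ω) = D.ρ₁ s * D.wordAct ω := by
  simp [wordAct]

theorem ρ₁_mem_weylGroup (s : S) : D.ρ₁ s ∈ weylGroup D.ρ₁ := Subgroup.subset_closure ⟨s, rfl⟩

theorem wordAct_mem_weylGroup (ω : List S) : D.wordAct ω ∈ weylGroup D.ρ₁ :=
  Subgroup.list_prod_mem _ (by simpa using fun s _ => D.ρ₁_mem_weylGroup s)

/-- After rescaling one root by `l`, the entries of the Cartan matrix at `s`, `t` are both `-c`. -/
structure IsScaling (s t : S) (l c : ℝ) : Prop where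
  pos : 0 < l
  cartan_left : D.cartan s t = -(l * c)
  cartan_right : l * D.cartan t s = -c

variable {D}

theorem IsScaling.symm {s t : S} {l c : ℝ} (h : D.IsScaling s t l c) : D.IsScaling t s l⁻¹ c := by
  have hl := h.pos.ne'
  refine ⟨inv_pos.2 h.pos, ?_, ?_⟩
  · rw [eq_comm, neg_eq_iff_eq_neg, ← mul_right_inj' hl, mul_inv_cancel_left₀ hl, mul_neg,
      h.cartan_right, neg_neg]
  · rw [h.cartan_left, mul_neg, inv_mul_cancel_left₀ hl]

theorem IsScaling.sq {s t : S} {l c : ℝ} (h : D.IsScaling s t l c) :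
    D.cartan s t * D.cartan t s = c ^ 2 := by
  rw [h.cartan_left]
  linear_combination (-c) * h.cartan_right

/-- For entries `-a, -b` with `a, b > 0`, symmetrizing forces `c = √(ab)` and `l = √(a/b)`.
Simultaneous vanishing is needed because a positive `l` cannot balance a zero against a nonzero
entry. -/
theorem exists_isScaling {s t : S} (hst : D.cartan s t ≤ 0) (hts : D.cartan t s ≤ 0)
    (h0 : D.cartan s t = 0 ↔ D.cartan t s = 0) : ∃ l c, 0 ≤ c ∧ D.IsScaling s t l c := by
  rcases hts.eq_or_lt with h | h
  · exact ⟨1, 0, le_rfl, one_pos, by simp [h0.2 h], by simp [h]⟩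
  · have hst' : D.cartan s t < 0 := hst.lt_of_ne fun e => h.ne (h0.1 e)
    set a := -D.cartan s t with ha
    set b := -D.cartan t s with hb
    have ha0 : 0 < a := by linarith
    have hb0 : 0 < b := by linarith
    have hsa := Real.sqrt_pos.2 ha0
    have hsb := Real.sqrt_pos.2 hb0
    have ea := Real.mul_self_sqrt ha0.le
    have eb := Real.mul_self_sqrt hb0.le
    refine ⟨√a / √b, √a * √b, by positivity, by positivity, ?_, ?_⟩
    · rw [← neg_eq_iff_eq_neg, ← ha]
      field_simp
      linarith
    · rw [show D.cartan t s = -(√b * √b) by rw [eb, hb, neg_neg]]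
      field_simp

/-- The action of alternating words in `s`, `t` on `α s`. -/
theorem IsScaling.wordAct_alternatingWord {s t : S} {l c : ℝ} (h : D.IsScaling s t l c) (k : ℕ) :
    D.wordAct (alternatingWord s t k) (D.α s) =
      if Even k then chebU c (k + 1) • D.α s + (l * chebU c k) • D.α t
      else chebU c k • D.α s + (l * chebU c (k + 1)) • D.α t := by
  induction k with
  | zero => simp [wordAct, alternatingWord]
  | succ k ih =>
    rw [alternatingWord_succ', wordAct_cons, LinearEquiv.mul_apply, ih]
    by_cases hk : Even k
    · simp only [hk, if_true, Nat.even_add_one, not_true, if_false, map_add, map_smul, ρ₁_α_self,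
        ρ₁_α D t s, h.cartan_left, chebU_add_two]
      module
    · have : D.ρ₁ s (l • D.α t) = l • D.α t + (2 * c) • D.α s := by
        rw [map_smul, ρ₁_α, smul_sub, smul_smul, mul_left_comm, h.cartan_right]
        module
      simp only [hk, if_false, Nat.even_add_one, not_false_eq_true, if_true, map_add,
        mul_comm l, mul_smul _ l, map_smul (D.ρ₁ s) (chebU _ _), this, ρ₁_α_self, chebU_add_two]
      module

theorem wordAct_alternatingWord_two_mul (s t : S) (m : ℕ) :
    D.wordAct (alternatingWord s t (2 * m)) = (D.ρ₁ s * D.ρ₁ t) ^ m := by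
  induction m with
  | zero => simp [wordAct, alternatingWord]
  | succ m ih =>
    rw [show 2 * (m + 1) = 2 * m + 1 + 1 by ring, alternatingWord_succ', alternatingWord_succ',
      wordAct_cons, wordAct_cons, ih, pow_succ']
    simp [mul_assoc]

/-- The alternating word of length `2 * m` turns the angle by `2π`, so the coefficients return to 1
and 0. -/
theorem IsScaling.pow_apply_α_left {s t : S} {l : ℝ} {m : ℕ} (hm : 2 ≤ m)
    (h : D.IsScaling s t l (Real.cos (Real.pi / m))) :
    ((D.ρ₁ s * D.ρ₁ t) ^ m) (D.α s) = D.α s := by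
  rw [← wordAct_alternatingWord_two_mul, h.wordAct_alternatingWord, if_pos (even_two_mul m),
    chebU_cos_pi_div_two_mul hm, chebU_cos_pi_div_two_mul_add_one hm]
  simp

theorem IsScaling.pow_apply_α_right {s t : S} {l : ℝ} {m : ℕ} (hm : 2 ≤ m)
    (h : D.IsScaling s t l (Real.cos (Real.pi / m))) :
    ((D.ρ₁ s * D.ρ₁ t) ^ m) (D.α t) = D.α t := by
  have h₁ := h.symm.pow_apply_α_left hm
  have h₂ : (D.ρ₁ s * D.ρ₁ t) ^ m * (D.ρ₁ t * D.ρ₁ s) ^ m = 1 := by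
    have : D.ρ₁ t * D.ρ₁ s = (D.ρ₁ s * D.ρ₁ t)⁻¹ := by
      rw [eq_inv_iff_mul_eq_one, mul_assoc, ← mul_assoc (D.ρ₁ s), ρ₁_mul_self, one_mul, ρ₁_mul_self]
    rw [this, inv_pow, mul_inv_cancel]
  calc ((D.ρ₁ s * D.ρ₁ t) ^ m) (D.α t)
      = ((D.ρ₁ s * D.ρ₁ t) ^ m * (D.ρ₁ t * D.ρ₁ s) ^ m) (D.α t) := by
        rw [LinearEquiv.mul_apply, h₁]
    _ = D.α t := by rw [h₂]; rfl

/-- The Gram determinant `1 - c_st * c_ts` is nonzero, so by Cramer's rule every vector is a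
combination of `α_s, α_t` plus a vector killed by `β_s` and `β_t`. Both reflections fix the latter,
and the power fixes `α_s` and `α_t`. -/
theorem IsScaling.pow_eq_one {s t : S} {l : ℝ} {m : ℕ} (hm : 2 ≤ m)
    (h : D.IsScaling s t l (Real.cos (Real.pi / m))) : (D.ρ₁ s * D.ρ₁ t) ^ m = 1 := by
  ext z
  have hdet : 1 - D.cartan s t * D.cartan t s ≠ 0 := by
    rw [h.sq]
    exact (sub_pos.2 (cos_pi_div_sq_lt_one hm)).ne'
  obtain ⟨p, q, hp, hq⟩ : ∃ p q : ℝ, D.pairing z (D.β s) = p + q * D.cartan t s ∧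
      D.pairing z (D.β t) = p * D.cartan s t + q := by
    obtain ⟨d, hd⟩ : ∃ d, (1 - D.cartan s t * D.cartan t s) * d = 1 := ⟨_, mul_inv_cancel₀ hdet⟩
    refine ⟨(D.pairing z (D.β s) - D.cartan t s * D.pairing z (D.β t)) * d,
      (D.pairing z (D.β t) - D.cartan s t * D.pairing z (D.β s)) * d, ?_, ?_⟩
    · linear_combination (-D.pairing z (D.β s)) * hd
    · linear_combination (-D.pairing z (D.β t)) * hd
  obtain ⟨z₀, hz⟩ : ∃ z₀, z = z₀ + (p • D.α s + q • D.α t) := ⟨_, (sub_add_cancel _ _).symm⟩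
  have hs : D.pairing z₀ (D.β s) = 0 := by
    have := D.pairing_self s
    rw [hz, cartan] at hp
    simp only [map_add, map_smul, LinearMap.add_apply, LinearMap.smul_apply, smul_eq_mul] at hp
    rw [this] at hp
    linarith
  have ht : D.pairing z₀ (D.β t) = 0 := by
    have := D.pairing_self t
    rw [hz, cartan] at hq
    simp only [map_add, map_smul, LinearMap.add_apply, LinearMap.smul_apply, smul_eq_mul] at hq
    rw [this] at hq
    linarith
  have hfix : (D.ρ₁ s * D.ρ₁ t) z₀ = z₀ := by
    simp [LinearEquiv.mul_apply, ρ₁_apply, hs, ht]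
  have hfix' : ∀ n : ℕ, ((D.ρ₁ s * D.ρ₁ t) ^ n) z₀ = z₀ := by
    intro n
    induction n with
    | zero => rfl
    | succ n ih => rw [pow_succ, LinearEquiv.mul_apply, hfix, ih]
  rw [hz, map_add, map_add, map_smul, map_smul, hfix', h.pow_apply_α_left hm,
    h.pow_apply_α_right hm]
  rfl

/-! ### Admissible data and their reflection representation. -/

variable (D)

/-- The condition on the Cartan matrix which characterizes the decomposition of the roots into
positive and negative ones. -/
def IsAdmissible : Prop :=
  ∀ s t, s ≠ t → D.cartan s t ≤ 0 ∧ (D.cartan s t = 0 → D.cartan t s = 0) ∧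
    (1 ≤ D.cartan s t * D.cartan t s ∨
      ∃ m : ℕ, 2 ≤ m ∧ D.cartan s t * D.cartan t s = Real.cos (Real.pi / m) ^ 2)

variable {D}

theorem IsAdmissible.swap (h : D.IsAdmissible) : D.swap.IsAdmissible := by
  intro s t hst
  have := h t s hst.symm
  exact this

theorem IsAdmissible.exists_isScaling (h : D.IsAdmissible) {s t : S} (hst : s ≠ t) :
    ∃ l c, D.IsScaling s t l c ∧
      (D.coxeterMatrix s t = 0 ∧ 1 ≤ c ∨
        2 ≤ D.coxeterMatrix s t ∧ c = Real.cos (Real.pi / D.coxeterMatrix s t)) := by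
  obtain ⟨h₁, h₂, h₃⟩ := h s t hst
  obtain ⟨k₁, k₂, -⟩ := h t s hst.symm
  obtain ⟨l, c, hc, hl⟩ := PairedRootDatum.exists_isScaling h₁ k₁ ⟨h₂, k₂⟩
  refine ⟨l, c, hl, ?_⟩
  rcases h₃ with h₃ | ⟨m, hm, h₃⟩
  · refine Or.inl ⟨D.order_eq_zero_of_one_le_cartan_mul hst h₃, ?_⟩
    rw [hl.sq] at h₃
    nlinarith
  · have hm' : D.coxeterMatrix s t = m := D.order_eq_of_cartan_mul hst hm h₃
    rw [hm']
    refine Or.inr ⟨hm, ?_⟩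
    rw [hl.sq] at h₃
    exact (pow_left_inj₀ hc (cos_pi_div_nonneg hm) two_ne_zero).1 h₃

theorem IsAdmissible.isLiftable (h : D.IsAdmissible) : D.coxeterMatrix.IsLiftable D.ρ₁ := by
  intro s t
  by_cases hst : s = t
  · subst hst
    rw [ρ₁_mul_self, one_pow]
  · obtain ⟨l, c, hl, ⟨h0, -⟩ | ⟨hm, rfl⟩⟩ := h.exists_isScaling hst
    · rw [h0, pow_zero]
    · exact hl.pow_eq_one hm

section Representation

variable {W : Type*} [Group W] (cs : CoxeterSystem D.coxeterMatrix W)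

/-- The reflection representation of the Coxeter group attached to an admissible datum. -/
noncomputable def rep (h : D.IsAdmissible) : W →* (V₁ ≃ₗ[ℝ] V₁) := cs.lift ⟨D.ρ₁, h.isLiftable⟩

theorem rep_simple (h : D.IsAdmissible) (s : S) : rep cs h (cs.simple s) = D.ρ₁ s :=
  cs.lift_apply_simple h.isLiftable s

theorem rep_wordProd (h : D.IsAdmissible) (ω : List S) :
    rep cs h (cs.wordProd ω) = D.wordAct ω := by
  rw [wordProd, map_list_prod, List.map_map, wordAct]
  congr 1
  exact List.map_congr_left fun s _ => rep_simple cs h s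

theorem range_rep (h : D.IsAdmissible) : (rep cs h).range = D.W₁ := by
  rw [MonoidHom.range_eq_map, ← cs.subgroup_closure_range_simple, MonoidHom.map_closure,
    ← Set.range_comp, W₁, weylGroup]
  congr 2
  exact funext (rep_simple cs h)

/-- If `s` is not a right descent of `w`, then `w (α s)` is a positive root. -/
theorem rep_apply_α_mem_PLC (h : D.IsAdmissible) (w : W) (s : S) (hs : ¬ cs.IsRightDescent w s) :
    rep cs h w (D.α s) ∈ PLC (Set.range D.α) := by
  induction hn : cs.length w using Nat.strong_induction_on generalizing w s with
  | _ n ih =>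
    subst hn
    by_cases hw : w = 1
    · subst hw
      simpa using D.α_mem_PLC s
    obtain ⟨t, ht⟩ := cs.exists_rightDescent_of_ne_one hw
    have hst : s ≠ t := by
      rintro rfl
      exact hs ht
    -- The alternating factor sends `α_s` to a nonnegative combination of `α_s, α_t`, and the
    -- shorter `v` sends both of these into the cone by induction.
    obtain ⟨v, k, rfl, hlt, hvs, hvt, hk⟩ := cs.exists_mul_alternatingWord hs ht
    obtain ⟨l, c, hl, hc⟩ := h.exists_isScaling hst
    have hU : 0 ≤ chebU c k ∧ 0 ≤ chebU c (k + 1) := by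
      rcases hc with ⟨-, hc⟩ | ⟨hm, rfl⟩
      · exact ⟨(chebU_nonneg_of_one_le hc _).1, (chebU_nonneg_of_one_le hc _).1⟩
      -- The bound `k < m` is what keeps the index `k + 1` in the range where the sequence is
      -- nonnegative.
      · have := hk (by omega)
        exact ⟨chebU_cos_pi_div_nonneg hm (by omega), chebU_cos_pi_div_nonneg hm (by omega)⟩
    obtain ⟨p, q, hp, hq, hpq⟩ : ∃ p q : ℝ, 0 ≤ p ∧ 0 ≤ q ∧
        D.wordAct (alternatingWord s t k) (D.α s) = p • D.α s + q • D.α t := by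
      rw [hl.wordAct_alternatingWord]
      split_ifs
      · exact ⟨_, _, hU.2, mul_nonneg hl.pos.le hU.1, rfl⟩
      · exact ⟨_, _, hU.1, mul_nonneg hl.pos.le hU.2, rfl⟩
    -- Not both coefficients vanish, since an automorphism cannot kill `α_s`.
    have hne : p ≠ 0 ∨ q ≠ 0 := by
      by_contra! h0
      rw [h0.1, h0.2, zero_smul, zero_smul, add_zero] at hpq
      exact D.α_ne_zero s ((LinearEquiv.map_eq_zero_iff _).1 hpq)
    rw [map_mul, LinearEquiv.mul_apply, rep_wordProd, hpq, map_add, map_smul, map_smul]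
    exact smul_add_smul_mem_PLC (ih _ hlt v s hvs rfl) (ih _ hlt v t hvt rfl) hp hq hne

theorem rep_mul_simple_apply (h : D.IsAdmissible) (w : W) (s : S) :
    rep cs h (w * cs.simple s) (D.α s) = -rep cs h w (D.α s) := by
  rw [map_mul, rep_simple, LinearEquiv.mul_apply, ρ₁_α_self, map_neg]

theorem neg_rep_apply_α_mem_PLC (h : D.IsAdmissible) (w : W) (s : S) (hs : cs.IsRightDescent w s) :
    -rep cs h w (D.α s) ∈ PLC (Set.range D.α) := by
  rw [← rep_mul_simple_apply]
  exact rep_apply_α_mem_PLC cs h _ s (cs.isRightDescent_iff_not_isRightDescent_mul.1 hs)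

theorem rep_injective (h : D.IsAdmissible) : Function.Injective (rep cs h) := by
  rw [injective_iff_map_eq_one]
  intro w hw
  by_contra hne
  obtain ⟨s, hs⟩ := cs.exists_rightDescent_of_ne_one hne
  have := neg_rep_apply_α_mem_PLC cs h w s hs
  rw [hw] at this
  exact neg_notMem_PLC D.zero_notMem_α (D.α_mem_PLC s) this

theorem IsAdmissible.exists_mulEquiv (h : D.IsAdmissible) :
    ∃ f : W ≃* D.W₁, ∀ s, (f (cs.simple s) : V₁ ≃ₗ[ℝ] V₁) = D.ρ₁ s :=
  ⟨(MonoidHom.ofInjective (rep_injective cs h)).trans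
    (MulEquiv.subgroupCongr (range_rep cs h)), fun s => rep_simple cs h s⟩

end Representation

/-! ### Admissibility versus root decomposition. -/

theorem IsAdmissible.decomposes₁ (h : D.IsAdmissible) : D.Decomposes₁ := by
  have hneg : ∀ x ∈ rootSet D.ρ₁ D.α, -x ∈ rootSet D.ρ₁ D.α := by
    rintro _ ⟨w, hw, s, rfl⟩
    refine ⟨w * D.ρ₁ s, mul_mem hw (D.ρ₁_mem_weylGroup s), s, ?_⟩
    rw [LinearEquiv.mul_apply, ρ₁_α_self, map_neg]
  refine ⟨Set.Subset.antisymm ?_ ?_, ?_⟩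
  · intro x hx
    obtain ⟨w, hw, s, rfl⟩ := id hx
    let cs := D.coxeterMatrix.toCoxeterSystem
    obtain ⟨g, rfl⟩ : w ∈ (rep cs h).range := by rwa [range_rep]
    by_cases hs : cs.IsRightDescent g s
    · exact Or.inr ⟨hneg _ hx, neg_rep_apply_α_mem_PLC cs h g s hs⟩
    · exact Or.inl ⟨hx, rep_apply_α_mem_PLC cs h g s hs⟩
  · rintro x (hx | hx)
    · exact hx.1
    · simpa using hneg _ hx.1
  · rw [Set.disjoint_left]
    exact fun x hx hx' => neg_notMem_PLC D.zero_notMem_α hx.2 hx'.2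

theorem Decomposes₁.mem_PLC_or (h : D.Decomposes₁) {x : V₁} (hx : x ∈ rootSet D.ρ₁ D.α) :
    x ∈ PLC (Set.range D.α) ∨ -x ∈ PLC (Set.range D.α) := by
  rw [h.1] at hx
  exact hx.imp And.right And.right

/-- A root in the plane of two simple roots has coefficients of the same sign. -/
theorem Decomposes₁.not_mixed (h : D.Decomposes₁) {s t : S} (hst : s ≠ t) {p q : ℝ} (hp : 0 < p)
    (hq : q < 0) : p • D.α s + q • D.α t ∉ rootSet D.ρ₁ D.α := by
  intro hx
  rcases h.mem_PLC_or hx with hx | hx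
  · rw [← sub_neg_eq_add, ← neg_smul] at hx
    exact smul_sub_smul_notMem_PLC D.zero_notMem_α ⟨s, rfl⟩ ⟨t, rfl⟩
      (D.α_injective.ne hst.symm) (D.α_notMem s) (neg_pos.2 hq) hx
  · rw [neg_add_rev, ← sub_eq_add_neg, ← neg_smul] at hx
    exact smul_sub_smul_notMem_PLC D.zero_notMem_α ⟨t, rfl⟩ ⟨s, rfl⟩
      (D.α_injective.ne hst) (D.α_notMem t) hp hx

theorem wordAct_α_mem_rootSet (ω : List S) (s : S) : D.wordAct ω (D.α s) ∈ rootSet D.ρ₁ D.α :=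
  ⟨_, D.wordAct_mem_weylGroup ω, s, rfl⟩

/-- A positive entry would make `ρ_t α_s = α_s - 2 c_st α_t` a mixed root. -/
theorem Decomposes₁.cartan_nonpos (h : D.Decomposes₁) {s t : S} (hst : s ≠ t) :
    D.cartan s t ≤ 0 := by
  by_contra! hpos
  refine h.not_mixed hst (p := 1) (q := -(2 * D.cartan s t)) one_pos (by linarith) ?_
  convert wordAct_α_mem_rootSet (D := D) [t] s using 1
  simp only [wordAct, List.map_cons, List.map_nil, List.prod_cons, List.prod_nil, mul_one, ρ₁_α]
  module

/-- If `c_st = 0`, then `ρ_t ρ_s α_t = -2 c_ts α_s - α_t`, which is mixed when `c_ts < 0`. -/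
theorem Decomposes₁.cartan_eq_zero (h : D.Decomposes₁) {s t : S} (hst : s ≠ t)
    (h0 : D.cartan s t = 0) : D.cartan t s = 0 := by
  by_contra hne
  have hlt : D.cartan t s < 0 := (h.cartan_nonpos hst.symm).lt_of_ne hne
  refine h.not_mixed hst (p := -(2 * D.cartan t s)) (q := -1) (by linarith) (by norm_num) ?_
  convert wordAct_α_mem_rootSet (D := D) [t, s] t using 1
  simp only [wordAct, List.map_cons, List.map_nil, List.prod_cons, List.prod_nil, mul_one,
    LinearEquiv.mul_apply, ρ₁_α, map_sub, map_smul, h0, cartan_self]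
  module

theorem Decomposes₁.isAdmissible (h : D.Decomposes₁) : D.IsAdmissible := by
  intro s t hst
  refine ⟨h.cartan_nonpos hst, h.cartan_eq_zero hst, ?_⟩
  obtain ⟨l, c, hc, hl⟩ := exists_isScaling (h.cartan_nonpos hst) (h.cartan_nonpos hst.symm)
    ⟨h.cartan_eq_zero hst, h.cartan_eq_zero hst.symm⟩
  rw [hl.sq]
  rcases le_or_gt 1 c with h1 | h1
  · exact Or.inl (one_le_pow₀ h1)
  · refine Or.inr ?_
    rcases exists_eq_cos_pi_div_or_chebU_sign_change hc h1 with ⟨m, hm, rfl⟩ | ⟨k, hk, hk'⟩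
    · exact ⟨m, hm, rfl⟩
    · exfalso
      have hroot := wordAct_α_mem_rootSet (D := D) (alternatingWord s t k) s
      rw [hl.wordAct_alternatingWord] at hroot
      split_ifs at hroot
      · rw [add_comm] at hroot
        exact h.not_mixed hst.symm (mul_pos hl.pos hk) hk' hroot
      · exact h.not_mixed hst hk (mul_neg_of_pos_of_neg hl.pos hk') hroot

theorem decomposes₁_iff_isAdmissible : D.Decomposes₁ ↔ D.IsAdmissible :=
  ⟨Decomposes₁.isAdmissible, IsAdmissible.decomposes₁⟩

theorem swap_decomposes₁ : D.swap.Decomposes₁ ↔ D.Decomposes₂ := Iff.rfl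

theorem decomposes₁_iff_decomposes₂ : D.Decomposes₁ ↔ D.Decomposes₂ := by
  rw [← swap_decomposes₁, decomposes₁_iff_isAdmissible, decomposes₁_iff_isAdmissible]
  exact ⟨fun h => h.swap, fun h => h.swap⟩

theorem IsAdmissible.exists_mulEquiv₂ (h : D.IsAdmissible) {W : Type*} [Group W]
    (cs : CoxeterSystem D.coxeterMatrix W) :
    ∃ f : W ≃* D.W₂, ∀ s, (f (cs.simple s) : V₂ ≃ₗ[ℝ] V₂) = D.ρ₂ s := by
  -- The type of `cs` depends on the matrix, so the matrix is made a variable before the equality is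
  -- substituted.
  have key : ∀ (M : CoxeterMatrix S) (cs : CoxeterSystem M W), M = D.swap.coxeterMatrix →
      ∃ f : W ≃* D.W₂, ∀ s, (f (cs.simple s) : V₂ ≃ₗ[ℝ] V₂) = D.ρ₂ s := by
    rintro _ cs rfl
    exact h.swap.exists_mulEquiv cs
  exact key _ cs D.swap_coxeterMatrix.symm

end PairedRootDatum

/-! ### The standard reflection representation. -/

namespace CoxeterMatrix

variable {S : Type*} (M : CoxeterMatrix S)

/-- The bilinear form of the standard reflection representation. -/
noncomputable def standardForm : (S →₀ ℝ) →ₗ[ℝ] (S →₀ ℝ) →ₗ[ℝ] ℝ :=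
  Finsupp.lsum ℝ fun s => LinearMap.toSpanSingleton ℝ _ <|
    Finsupp.lsum ℝ fun t => LinearMap.toSpanSingleton ℝ ℝ (-Real.cos (Real.pi / M s t))

theorem standardForm_single (s t : S) :
    M.standardForm (Finsupp.single s 1) (Finsupp.single t 1) = -Real.cos (Real.pi / M s t) := by
  simp [standardForm]

/-- The sum of coordinates is positive on every generator. -/
theorem zero_notMem_PLC_single :
    (0 : S →₀ ℝ) ∉ PLC (Set.range fun s : S => Finsupp.single s (1 : ℝ)) := fun h =>
  lt_irrefl (0 : ℝ) <| by
    simpa using map_pos_of_mem_PLC (Finsupp.lsum ℝ fun _ => LinearMap.id)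
      (by rintro _ ⟨s, rfl⟩; simp) h

/-- The coordinate at `s` kills all the other generators. -/
theorem single_notMem_PLC (s : S) : Finsupp.single s (1 : ℝ) ∉
    PLC (Set.range (fun s : S => Finsupp.single s (1 : ℝ)) \ {Finsupp.single s 1}) := fun h =>
  one_ne_zero (α := ℝ) <| by
    simpa using map_eq_zero_of_mem_PLC (Finsupp.lapply s) (by
      rintro _ ⟨⟨t, rfl⟩, ht⟩
      have : t ≠ s := by
        rintro rfl
        exact ht rfl
      simp [Finsupp.single_eq_of_ne' this]) h

/-- The datum underlying the standard reflection representation. -/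
noncomputable def standardDatum : PairedRootDatum S (S →₀ ℝ) (S →₀ ℝ) where
  pairing := M.standardForm
  α s := Finsupp.single s 1
  β s := Finsupp.single s 1
  α_injective := Finsupp.single_left_injective one_ne_zero
  β_injective := Finsupp.single_left_injective one_ne_zero
  pairing_self s := by simp [standardForm_single]
  zero_notMem_α := zero_notMem_PLC_single
  zero_notMem_β := zero_notMem_PLC_single
  α_notMem := single_notMem_PLC
  β_notMem := single_notMem_PLC

theorem standardDatum_cartan (s t : S) :
    M.standardDatum.cartan s t = -Real.cos (Real.pi / M s t) := M.standardForm_single s t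

theorem standardDatum_cartan_mul (s t : S) :
    M.standardDatum.cartan s t * M.standardDatum.cartan t s = Real.cos (Real.pi / M s t) ^ 2 := by
  rw [standardDatum_cartan, standardDatum_cartan, M.symmetric t s]
  ring

theorem eq_zero_or_two_le {s t : S} (hst : s ≠ t) : M s t = 0 ∨ 2 ≤ M s t := by
  have := M.off_diagonal s t hst
  omega

theorem standardDatum_coxeterMatrix : M.standardDatum.coxeterMatrix = M := by
  refine CoxeterMatrix.ext (funext fun s => funext fun t => ?_)
  change M.standardDatum.order s t = M s t
  by_cases hst : s = t
  · subst hst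
    simp [PairedRootDatum.order]
  · have hmul := M.standardDatum_cartan_mul s t
    rcases M.eq_zero_or_two_le hst with h | h
    -- Infinite order is encoded as 0, and `π / 0 = 0` gives `cos 0 = 1`, so the product is 1 as
    -- required.
    · rw [h] at hmul ⊢
      exact M.standardDatum.order_eq_zero_of_one_le_cartan_mul hst (by simp [hmul])
    · exact M.standardDatum.order_eq_of_cartan_mul hst h hmul

theorem standardDatum_isAdmissible : M.standardDatum.IsAdmissible := by
  intro s t hst
  have hmul := M.standardDatum_cartan_mul s t
  refine ⟨?_, ?_, ?_⟩
  · rw [standardDatum_cartan]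
    rcases M.eq_zero_or_two_le hst with h | h
    · simp [h]
    · exact neg_nonpos.2 (cos_pi_div_nonneg h)
  · rw [standardDatum_cartan, standardDatum_cartan, M.symmetric s t]
    exact id
  · rcases M.eq_zero_or_two_le hst with h | h
    · exact Or.inl (by simp [hmul, h])
    · exact Or.inr ⟨_, h, hmul⟩

end CoxeterMatrix

/-! ### The main theorem. -/

theorem theorem2p7 (S : Type u) :
    (∀ (V₁ : Type v₁) (V₂ : Type v₂) [AddCommGroup V₁] [Module ℝ V₁] [AddCommGroup V₂] [Module ℝ V₂]
        (D : PairedRootDatum S V₁ V₂),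
      (D.Decomposes₁ ↔ D.Decomposes₂) ∧
      ∀ (W : Type w) [Group W] (cs : CoxeterSystem D.coxeterMatrix W), D.Decomposes₁ →
        (∃ f₁ : W ≃* D.W₁, ∀ s, (f₁ (cs.simple s) : V₁ ≃ₗ[ℝ] V₁) = D.ρ₁ s) ∧
        (∃ f₂ : W ≃* D.W₂, ∀ s, (f₂ (cs.simple s) : V₂ ≃ₗ[ℝ] V₂) = D.ρ₂ s)) ∧
    (∀ (G : Type w') [Group G] (r : S → G),
      (∃ (M : CoxeterMatrix S) (cs : CoxeterSystem M G), ∀ s, cs.simple s = r s) ↔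
      ∃ (V₁ V₂ : Type u) (_ : AddCommGroup V₁) (_ : Module ℝ V₁)
        (_ : AddCommGroup V₂) (_ : Module ℝ V₂) (D : PairedRootDatum S V₁ V₂),
        D.Decomposes₁ ∧ ∃ f : G ≃* D.W₁, ∀ s, (f (r s) : V₁ ≃ₗ[ℝ] V₁) = D.ρ₁ s) := by
  refine ⟨?_, ?_⟩
  · intro V₁ V₂ _ _ _ _ D
    exact ⟨PairedRootDatum.decomposes₁_iff_decomposes₂, fun W _ cs h =>
      ⟨h.isAdmissible.exists_mulEquiv cs, h.isAdmissible.exists_mulEquiv₂ cs⟩⟩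
  · intro G _ r
    constructor
    · rintro ⟨M, cs, hr⟩
      have hadm := M.standardDatum_isAdmissible
      obtain ⟨f, hf⟩ : ∃ f : G ≃* M.standardDatum.W₁,
          ∀ s, (f (cs.simple s) : (S →₀ ℝ) ≃ₗ[ℝ] (S →₀ ℝ)) = M.standardDatum.ρ₁ s := by
        have key : ∀ (N : CoxeterMatrix S) (cs : CoxeterSystem N G),
            N = M.standardDatum.coxeterMatrix → ∃ f : G ≃* M.standardDatum.W₁,
              ∀ s, (f (cs.simple s) : (S →₀ ℝ) ≃ₗ[ℝ] (S →₀ ℝ)) = M.standardDatum.ρ₁ s := by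
          rintro _ cs rfl
          exact hadm.exists_mulEquiv cs
        exact key M cs M.standardDatum_coxeterMatrix.symm
      exact ⟨S →₀ ℝ, S →₀ ℝ, inferInstance, inferInstance, inferInstance, inferInstance,
        M.standardDatum, hadm.decomposes₁, f, fun s => by rw [← hr, hf]⟩
    · rintro ⟨V₁, V₂, _, _, _, _, D, hD, f, hf⟩
      obtain ⟨g, hg⟩ := hD.isAdmissible.exists_mulEquiv D.coxeterMatrix.toCoxeterSystem
      -- The Coxeter structure is transported to `G` through `W₁`.
      refine ⟨D.coxeterMatrix, D.coxeterMatrix.toCoxeterSystem.map (g.trans f.symm), fun s => ?_⟩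
      rw [CoxeterSystem.map_simple, MulEquiv.trans_apply, MulEquiv.symm_apply_eq]
      exact Subtype.ext ((hg s).trans (hf s).symm)
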